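/- Let $G$ be a group and let $\mathscr{G}$ be a collection of subgroups of $G$. For a finite generating set $S$ of $G$, the \emph{coned-off graph} $\hat\Gamma$ of the Cayley graph $\Gamma=\operatorname{Cay}(G,S)$ is the graph with vertex set $G\sqcup\bigsqcup_{H\in\mathscr{G}}G/H$ whose edges are the edges of $\Gamma$ together with an edge from $x\in G$ to the vertex $gH\in G/H$ whenever $H \in \mathscr{G}$ and $x\in gH$. Suppose that $G$ is \emph{hyperbolic relative to} $\mathscr{G}$, i.e. that for some finite generating set $S$ the graph $\hat\Gamma$ is hyperbolic (it is connected and, for some $\delta>0$, each side of every geodesic triangle is contained in the $\delta$-neighbourhood of the union of the other two sides) and fine (for every integer $n$, each edge is contained in only finitely many loops of length $n$, where a loop is a closed path without other repetition of vertices). For a subgroup $H$ of $G$ let $LH\subset LG\subset B(\ell^2(G))$ denote the von Neumann algebra generated by the left translation unitaries $u_h$, $h\in H$. Let $\tau(x)=\langle x\delta_1,\delta_1\rangle$ be the canonical trace on $LG$ and $\|x\|_2=\tau(x^*x)^{1/2}$. A von Neumann subalgebra $P\subset LG$ has \emph{property Gamma} if it is diffuse (it has no minimal projection) and there is a sequence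 of unitaries $(u_n)_n$ in $P$ which tends weakly to $0$ and satisfies $\lim_n\|xu_n-u_nx\|_2=0$ for every $x\in P$. \textbf{Theorem B.} Let $G$ be hyperbolic relative to $\mathscr{G}$ and let $H\in\mathscr{G}$ be an infinite subgroup such that $LH$ has property Gamma. Then $LH$ is maximal Gamma inside $LG$: $LH$ has property Gamma, and every von Neumann subalgebra $P$ with $LH\subset P\subset LG$ that has property Gamma is equal to $LH$. -/

import Mathlib

open Filter Topology
open scoped InnerProductSpace ENNReal

/-! ### Hyperbolic graphs, fine graphs, coned-off Cayley graphs -/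

/-- A walk is a geodesic if its length is the distance between its endpoints. -/
def SimpleGraph.Walk.IsGeodesic {V : Type*} {K : SimpleGraph V} {x y : V} (p : K.Walk x y) : Prop :=
  p.length = K.dist x y

/-- A connected graph is hyperbolic if, for some `δ > 0`, every geodesic triangle is `δ`-thin:
each side lies in the `δ`-neighbourhood of the union of the other two sides. (The condition is
spelled out for the first side; the quantification over all triangles covers the other two.) -/
def SimpleGraph.IsHyperbolic {V : Type*} (K : SimpleGraph V) : Prop :=
  K.Connected ∧ ∃ δ : ℝ, 0 < δ ∧
    ∀ (x y z : V) (p : K.Walk x y) (q : K.Walk y z) (r : K.Walk z x),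
      p.IsGeodesic → q.IsGeodesic → r.IsGeodesic →
        ∀ v ∈ p.support, ∃ w, (w ∈ q.support ∨ w ∈ r.support) ∧ (K.dist v w : ℝ) ≤ δ

/-- A graph is fine if, for every integer `n`, each edge is contained in only finitely many loops
(closed paths without other repetition of vertices) of length `n`. -/
def SimpleGraph.IsFine {V : Type*} (K : SimpleGraph V) : Prop :=
  ∀ e ∈ K.edgeSet, ∀ n : ℕ,
    {c : Σ v : V, K.Walk v v | c.2.IsCycle ∧ c.2.length = n ∧ e ∈ c.2.edges}.Finite

section RelativelyHyperbolic

variable {G : Type*} [Group G]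

/-- Vertices of the coned-off graph: the group elements, and a vertex for each left coset `gH`
of each member `H` of the collection. -/
abbrev ConedOffVertex (𝒢 : Set (Subgroup G)) : Type _ :=
  G ⊕ (Σ H : 𝒢, G ⧸ (H : Subgroup G))

/-- The coned-off graph of `Cay(G, S)` with respect to a collection `𝒢` of subgroups: the Cayley
graph, together with an edge from `x` to the vertex `gH` whenever `x ∈ gH`, `H ∈ 𝒢`. -/
def conedOffGraph (S : Set G) (𝒢 : Set (Subgroup G)) : SimpleGraph (ConedOffVertex 𝒢) where
  Adj
    | .inl x, .inl y => (SimpleGraph.mulCayley S).Adj x y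
    | .inl x, .inr c => (x : G ⧸ (c.1 : Subgroup G)) = c.2
    | .inr c, .inl x => (x : G ⧸ (c.1 : Subgroup G)) = c.2
    | .inr _, .inr _ => False
  symm := ⟨by
    rintro (x | c) (y | d) h
    · exact SimpleGraph.Adj.symm h
    · exact h
    · exact h
    · exact h⟩
  loopless := ⟨by
    rintro (x | c) h
    · exact SimpleGraph.irrefl _ h
    · exact h⟩

/-- `G` is hyperbolic relative to the collection `𝒢` of subgroups if for some finite generating
set `S` the coned-off graph of `Cay(G, S)` with respect to `𝒢` is fine and hyperbolic. -/
def IsHyperbolicRelativeTo (𝒢 : Set (Subgroup G)) : Prop :=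
  ∃ S : Set G, S.Finite ∧ Subgroup.closure S = ⊤ ∧
    (conedOffGraph S 𝒢).IsFine ∧ (conedOffGraph S 𝒢).IsHyperbolic

end RelativelyHyperbolic

/-! ### Von Neumann algebras and property Gamma -/

section VonNeumann

variable {K : Type*} [NormedAddCommGroup K] [InnerProductSpace ℂ K] [CompleteSpace K]

/-- The von Neumann algebra on `K` generated by a set `s` of operators: the double commutant of
`s ∪ s*`. -/
noncomputable def vonNeumannClosure (s : Set (K →L[ℂ] K)) : VonNeumannAlgebra K where
  toStarSubalgebra :=
    StarSubalgebra.centralizer ℂ (StarSubalgebra.centralizer ℂ s : Set (K →L[ℂ] K))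
  centralizer_centralizer' := by
    change Set.centralizer (Set.centralizer
      ((StarSubalgebra.centralizer ℂ (StarSubalgebra.centralizer ℂ s : Set (K →L[ℂ] K)) :
        StarSubalgebra ℂ (K →L[ℂ] K)) : Set (K →L[ℂ] K))) =
      ((StarSubalgebra.centralizer ℂ (StarSubalgebra.centralizer ℂ s : Set (K →L[ℂ] K)) :
        StarSubalgebra ℂ (K →L[ℂ] K)) : Set (K →L[ℂ] K))
    rw [StarSubalgebra.coe_centralizer_centralizer, Set.centralizer_centralizer_centralizer]

/-- A von Neumann algebra is diffuse if it has no minimal projection: every nonzero projection in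
it strictly dominates a nonzero projection in it. -/
def VonNeumannAlgebra.IsDiffuse (M : VonNeumannAlgebra K) : Prop :=
  ∀ p ∈ M, IsStarProjection p → p ≠ 0 →
    ∃ q ∈ M, IsStarProjection q ∧ q * p = q ∧ q ≠ 0 ∧ q ≠ p

/-- The `2`-norm `‖x‖₂ = τ(x* x)^(1/2)` associated with a functional `τ`. -/
noncomputable def traceTwoNorm (τ : (K →L[ℂ] K) → ℂ) (x : K →L[ℂ] K) : ℝ :=
  √(τ (star x * x)).re

/-- Property Gamma of a von Neumann algebra `M` on which `τ` is a faithful normal tracial state: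
`M` is diffuse, and there is a sequence of unitaries `uₙ` of `M` tending weakly to `0` with
`‖x uₙ - uₙ x‖₂ → 0` for every `x` in `M`. -/
def VonNeumannAlgebra.HasPropertyGamma (M : VonNeumannAlgebra K) (τ : (K →L[ℂ] K) → ℂ) : Prop :=
  M.IsDiffuse ∧ ∃ u : ℕ → (K →L[ℂ] K),
    (∀ n, u n ∈ M ∧ u n ∈ unitary (K →L[ℂ] K)) ∧
    (∀ ξ η : K, Tendsto (fun n => ⟪ξ, u n η⟫_ℂ) atTop (𝓝 0)) ∧
    ∀ x ∈ M, Tendsto (fun n => traceTwoNorm τ (x * u n - u n * x)) atTop (𝓝 0)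

/-- `N` is maximal Gamma inside `M`: it is maximal among the von Neumann subalgebras of `M` that
have property Gamma (with respect to the trace `τ` of `M`). -/
def VonNeumannAlgebra.IsMaximalGammaIn (N M : VonNeumannAlgebra K) (τ : (K →L[ℂ] K) → ℂ) : Prop :=
  Maximal (fun P : VonNeumannAlgebra K => P ≤ M ∧ P.HasPropertyGamma τ) N

end VonNeumann

/-! ### Group von Neumann algebras -/

section GroupVonNeumann

variable {G : Type*} [Group G]

/-- The Hilbert space `ℓ²(G)`. -/
abbrev EllTwo (G : Type*) : Type _ := lp (fun _ : G => ℂ) 2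

theorem memlp_translate (g : G) (f : EllTwo G) : Memℓp (fun x : G => f (g⁻¹ * x)) 2 := by
  have h := (memℓp_gen_iff (p := 2) (by simp)).1 f.2
  exact (memℓp_gen_iff (p := 2) (by simp)).2 ((Equiv.mulLeft g⁻¹).summable_iff.2 h)

/-- The left regular representation: the unitary `u_g` with `(u_g f)(x) = f(g⁻¹ x)`. -/
noncomputable def leftRegular (g : G) : EllTwo G →ₗᵢ[ℂ] EllTwo G where
  toFun f := ⟨fun x => f (g⁻¹ * x), memlp_translate g f⟩
  map_add' _ _ := rfl
  map_smul' _ _ := rfl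
  norm_map' f := by
    rw [lp.norm_eq_tsum_rpow (p := 2) (by simp), lp.norm_eq_tsum_rpow (p := 2) (by simp)]
    congr 1
    exact (Equiv.mulLeft g⁻¹).tsum_eq (fun x => ‖f x‖ ^ (2 : ℝ≥0∞).toReal)

/-- The group von Neumann algebra `LH` of a subgroup `H` of `G`, as a von Neumann subalgebra of
`LG`: it is generated by the canonical unitaries `u_h`, `h ∈ H`, on `ℓ²(G)`. The algebra `LG`
itself is the case `H = ⊤`. -/
noncomputable def groupVN (H : Subgroup G) : VonNeumannAlgebra (EllTwo G) :=
  vonNeumannClosure {T | ∃ h ∈ H, T = (leftRegular h).toContinuousLinearMap}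

open Classical in
/-- The canonical trace `τ(x) = ⟨x δ₁, δ₁⟩` of `LG`. -/
noncomputable def groupTrace (G : Type*) [Group G] (x : EllTwo G →L[ℂ] EllTwo G) : ℂ :=
  ⟪(lp.single 2 (1 : G) (1 : ℂ) : EllTwo G), x (lp.single 2 (1 : G) (1 : ℂ))⟫_ℂ

end GroupVonNeumann

/-!
The proof combines a geometric fact about the vertex `c = H` of the coned-off graph with an
asymptotic orthogonality argument in the style of Popa.

*Geometry.* Fineness means that only finitely many edges at `c` make a bounded angle with a given
edge (`SimpleGraph.IsFine.finite_linked`), and hyperbolicity means that two geodesics leaving `c`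
at a large angle form a geodesic together (`SimpleGraph.IsHyperbolic.exists_linked_or_dist_eq`).
For `a, b ∉ H` and `s = a⁻¹ t b`, consider the vertex `asH = tbH`. If the geodesic from `H` to `sH`
starts far from `1`, a geodesic from `H` to `asH` passes through `aH`, so it starts near a point
depending on `a` only. If `t ∉ H` and the geodesics from `H` to `tH` and to `t⁻¹H` start far from
`1`, a geodesic from `H` to `tbH` starts like the one to `tH`, which is far away. So one of `s`, `t`
lies in a set `D ∪ E ∪ E⁻¹`, where `D` is finite and `E` consists of the `g` whose geodesics from
`H` to `gH` start in a fixed finite set (`IsHyperbolicRelativeTo.exists_isDisplacedBy`). As `H` is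
infinite, `E` has infinitely many pairwise disjoint conjugates by elements of `H`.

*Operator algebra.* Let `P ⊇ LH` have property Gamma, with unitaries `u_n`. Their coefficient
vectors `u_n δ_1` are asymptotically invariant under conjugation by `H`, so they have asymptotically
no mass on `E` and `E⁻¹`, nor on `D` as `u_n → 0` weakly. Hence `u_a u_n` and `u_n u_b` are
asymptotically orthogonal for `a, b ∉ H`
(`IsHyperbolicRelativeTo.tendsto_inner_translates`). For `x ∈ P`, the part of the Fourier series of
`x` on `H` commutes asymptotically with `u_n`, so the part `x'` off `H` does too; but `x' u_n` and
`u_n x'` are asymptotically orthogonal of norm `‖x'‖₂`, so `x' = 0` and `x ∈ LH`.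
-/

open scoped Pointwise

/-! ### Large angles in fine hyperbolic graphs -/

namespace SimpleGraph

variable {V : Type*} {K : SimpleGraph V}

/-- `K.Linked c L x y` says that `x` and `y` are joined by a walk of length at most `L` that avoids
the vertex `c`. When `x` and `y` are neighbours of `c`, it says that the angle at `c` between the
edges `cx` and `cy` is at most `L`. -/
def Linked (K : SimpleGraph V) (c : V) (L : ℕ) (x y : V) : Prop :=
  ∃ p : K.Walk x y, p.length ≤ L ∧ c ∉ p.support

/-- The edge `cx` is the first edge of a geodesic from `c` to `v`. -/
def IsFirstStep (K : SimpleGraph V) (c v x : V) : Prop :=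
  K.Adj c x ∧ K.dist c v = K.dist x v + 1

namespace Linked

variable {c x y z : V} {L M : ℕ}

theorem symm (h : K.Linked c L x y) : K.Linked c L y x := by
  obtain ⟨p, hp, hc⟩ := h
  exact ⟨p.reverse, by simpa using hp, by simpa using hc⟩

theorem trans (h : K.Linked c L x y) (h' : K.Linked c M y z) : K.Linked c (L + M) x z := by
  obtain ⟨p, hp, hc⟩ := h
  obtain ⟨q, hq, hc'⟩ := h'
  refine ⟨p.append q, by rw [Walk.length_append]; omega, ?_⟩
  rw [Walk.mem_support_append_iff]
  tauto

theorem mono (h : K.Linked c L x y) (hLM : L ≤ M) : K.Linked c M x y := by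
  obtain ⟨p, hp, hc⟩ := h
  exact ⟨p, hp.trans hLM, hc⟩

end Linked

/-- In a fine graph, only finitely many edges at `c` make an angle at most `L` with a given one:
closing up a path of length at most `L` that avoids `c` gives a cycle of length at most `L + 2`. -/
theorem IsFine.finite_linked (hK : K.IsFine) {c y : V} (hy : K.Adj c y) (L : ℕ) :
    {x | K.Adj c x ∧ K.Linked c L y x}.Finite := by
  classical
  have hfin : (⋃ n ∈ Set.Iic (L + 2), {d : Σ v : V, K.Walk v v |
      d.2.IsCycle ∧ d.2.length = n ∧ s(c, y) ∈ d.2.edges}).Finite :=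
    (Set.finite_Iic (L + 2)).biUnion fun n _ => hK _ hy n
  refine ((hfin.image fun d => d.2.penultimate).union (Set.finite_singleton y)).subset ?_
  rintro x ⟨hx, p, hp, hc⟩
  by_cases hxy : x = y
  · exact Or.inr hxy
  left
  have hc' : c ∉ p.bypass.support := fun h => hc (p.support_bypass_subset_support h)
  have hlen := p.length_bypass_le_length
  let r : K.Walk y c := p.bypass.concat hx.symm
  have hr : r.IsPath := p.bypass_isPath.concat hc' _
  have hcyc : (Walk.cons hy r).IsCycle := by
    rw [Walk.cons_isCycle_iff]
    refine ⟨hr, fun h => ?_⟩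
    rw [Walk.edges_concat, List.concat_eq_append, List.mem_append, List.mem_singleton] at h
    rcases h with h | h
    · exact hc' (Walk.fst_mem_support_of_mem_edges _ h)
    · have := hx.ne
      have := hy.ne
      simp only [Sym2.eq_iff] at h
      rcases h with h | h
      · exact this h.2.symm
      · exact hxy h.2.symm
  refine ⟨⟨c, Walk.cons hy r⟩, ?_, ?_⟩
  · simp only [Set.mem_iUnion, Set.mem_Iic]
    refine ⟨_, ?_, hcyc, rfl, by simp⟩
    simp only [Walk.length_cons, r, Walk.length_concat]
    omega
  · have hnn : ¬ r.Nil := by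
      intro h
      have := Walk.length_eq_zero_iff.2 h
      simp [r] at this
    change (Walk.cons hy r).penultimate = x
    rw [Walk.penultimate_cons_of_not_nil _ _ hnn]
    simp [r]

theorem Walk.dist_le_of_mem_support {x y z : V} (p : K.Walk x y) (hz : z ∈ p.support) :
    K.dist x z ≤ p.length := by
  classical
  exact (dist_le (p.takeUntil z hz)).trans (p.length_takeUntil_le_length hz)

/-- Two vertices of a geodesic that avoids `c` are linked by the part of it between them. -/
theorem Walk.IsGeodesic.linked {v w q q' c : V} {p : K.Walk v w} (hp : p.IsGeodesic)
    (hc : c ∉ p.support) (hq : q ∈ p.support) (hq' : q' ∈ p.support) :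
    K.Linked c (K.dist q q') q q' := by
  classical
  have h := hq'
  rw [← p.take_spec hq, Walk.mem_support_append_iff] at h
  rcases h with h | h
  · have hsub : ((p.takeUntil q hq).dropUntil q' h).IsSubwalk p :=
      (Walk.isSubwalk_dropUntil _ h).trans (Walk.isSubwalk_takeUntil _ hq)
    rw [dist_comm]
    exact Linked.symm ⟨_, (length_eq_dist_of_subwalk hp hsub).le,
      fun h' => hc (hsub.support_subset h')⟩
  · have hsub : ((p.dropUntil q hq).takeUntil q' h).IsSubwalk p :=
      (Walk.isSubwalk_takeUntil _ h).trans (Walk.isSubwalk_dropUntil _ hq)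
    exact ⟨_, (length_eq_dist_of_subwalk hp hsub).le, fun h' => hc (hsub.support_subset h')⟩

/-- One half of the thin triangle argument: the geodesic from `c` to `v` through `x` leads
within bounded distance either to a geodesic from `v` to `w`, or to `y`, without meeting `c`. -/
theorem linked_or_exists_linked_mem {D : ℕ} (hconn : K.Connected)
    (hD : ∀ (x y z : V) (p : K.Walk x y) (q : K.Walk y z) (r : K.Walk z x),
      p.IsGeodesic → q.IsGeodesic → r.IsGeodesic →
        ∀ v ∈ p.support, ∃ w, (w ∈ q.support ∨ w ∈ r.support) ∧ K.dist v w ≤ D)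
    {c v w x y : V} (hx : K.IsFirstStep c v x) (hy : K.IsFirstStep c w y)
    {p : K.Walk v w} (hp : p.IsGeodesic) (hc : c ∉ p.support) :
    K.Linked c (4 * D + 2) x y ∨ ∃ q ∈ p.support, K.Linked c (4 * D + 2) x q := by
  classical
  obtain ⟨px, hpx⟩ := hconn.exists_walk_length_eq_dist x v
  obtain ⟨py, hpy⟩ := hconn.exists_walk_length_eq_dist y w
  have hcpx : c ∉ px.support := by
    intro h
    have h1 := dist_le (px.dropUntil c h)
    have h2 := px.length_dropUntil_le_length h
    have := hx.2
    omega
  have hcpy : c ∉ py.support := by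
    intro h
    have h1 := dist_le (py.dropUntil c h)
    have h2 := py.length_dropUntil_le_length h
    have := hy.2
    omega
  have hgx : (Walk.cons hx.1 px).IsGeodesic := by
    rw [Walk.IsGeodesic, Walk.length_cons, hpx, hx.2]
  have hgy : (Walk.cons hy.1 py).IsGeodesic := by
    rw [Walk.IsGeodesic, Walk.length_cons, hpy, hy.2]
  have hcx : K.dist c x = 1 := dist_eq_one_iff_adj.2 hx.1
  have hcy : K.dist c y = 1 := dist_eq_one_iff_adj.2 hy.1
  by_cases hDv : K.dist x v ≤ D
  · exact Or.inr ⟨v, p.start_mem_support, px, by omega, hcpx⟩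
  push Not at hDv
  -- The vertex of the geodesic at distance `D + 1` from `c`.
  set m := px.getVert D
  have hxm : (px.take D).length ≤ D := by rw [Walk.take_length]; omega
  have hmv : (px.drop D).length = K.dist x v - D := by rw [Walk.drop_length, hpx]
  have hcm : D + 1 ≤ K.dist c m := by
    have h1 := hconn.dist_triangle (u := c) (v := m) (w := v)
    have h2 : K.dist m v ≤ _ := dist_le (px.drop D)
    have := hx.2
    rw [hmv] at h2
    omega
  have hcm' : K.dist c m ≤ D + 1 := by
    have h1 := hconn.dist_triangle (u := c) (v := x) (w := m)
    have h2 : K.dist x m ≤ _ := dist_le (px.take D)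
    omega
  have hlxm : K.Linked c D x m :=
    ⟨px.take D, hxm, fun h => hcpx ((px.isSubwalk_take D).support_subset h)⟩
  obtain ⟨z, hz, hmz⟩ := hD _ _ _ (Walk.cons hx.1 px) p (Walk.cons hy.1 py).reverse hgx hp
    (by rw [Walk.IsGeodesic, Walk.length_reverse, hgy, dist_comm]) m
    (by rw [Walk.support_cons]; exact List.mem_cons_of_mem _ (px.getVert_mem_support D))
  have hlmz : K.Linked c D m z := by
    obtain ⟨r, hr⟩ := hconn.exists_walk_length_eq_dist m z
    refine ⟨r, by omega, fun h => ?_⟩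
    have h1 := r.dist_le_of_mem_support h
    rw [dist_comm] at h1
    omega
  have hlxz := hlxm.trans hlmz
  rcases hz with hz | hz
  · exact Or.inr ⟨z, hz, hlxz.mono (by omega)⟩
  · left
    rw [Walk.support_reverse, List.mem_reverse, Walk.support_cons, List.mem_cons] at hz
    rcases hz with rfl | hz
    · rw [dist_comm] at hmz
      omega
    · have h1 := Walk.IsGeodesic.linked (p := py) hpy hcpy hz py.start_mem_support
      refine (hlxz.trans h1).mono ?_
      have h2 := hconn.dist_triangle (u := z) (v := m) (w := y)
      have h3 := hconn.dist_triangle (u := m) (v := c) (w := y)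
      have h4 := dist_comm (G := K) (u := z) (v := m)
      have h5 := dist_comm (G := K) (u := m) (v := c)
      omega

/-- In a hyperbolic graph, geodesics that leave `c` at a large angle fit together to a geodesic. -/
theorem IsHyperbolic.exists_linked_or_dist_eq (hK : K.IsHyperbolic) :
    ∃ L : ℕ, ∀ c v w x y : V, K.IsFirstStep c v x → K.IsFirstStep c w y →
      K.Linked c L x y ∨ K.dist v w = K.dist v c + K.dist c w := by
  classical
  obtain ⟨hconn, δ, -, hδ⟩ := hK
  have hD : ∀ (x y z : V) (p : K.Walk x y) (q : K.Walk y z) (r : K.Walk z x),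
      p.IsGeodesic → q.IsGeodesic → r.IsGeodesic →
        ∀ v ∈ p.support, ∃ w, (w ∈ q.support ∨ w ∈ r.support) ∧ K.dist v w ≤ ⌈δ⌉₊ := by
    intro x y z p q r hp hq hr v hv
    obtain ⟨w, hw, hd⟩ := hδ x y z p q r hp hq hr v hv
    exact ⟨w, hw, by exact_mod_cast hd.trans (Nat.le_ceil δ)⟩
  set M := 4 * ⌈δ⌉₊ + 2
  refine ⟨4 * M + 2, fun c v w x y hx hy => ?_⟩
  obtain ⟨p, hp⟩ := hconn.exists_walk_length_eq_dist v w
  by_cases hc : c ∈ p.support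
  · right
    have h1 := congrArg Walk.length (p.take_spec hc)
    rw [Walk.length_append] at h1
    have h2 := dist_le (p.takeUntil c hc)
    have h3 := dist_le (p.dropUntil c hc)
    have h4 := hconn.dist_triangle (u := v) (v := c) (w := w)
    omega
  left
  rcases linked_or_exists_linked_mem hconn hD hx hy hp hc with h | ⟨q, hq, hxq⟩
  · exact h.mono (by omega)
  have hp' : p.reverse.IsGeodesic := by
    rw [Walk.IsGeodesic, Walk.length_reverse, hp, dist_comm]
  rcases linked_or_exists_linked_mem hconn hD hy hx hp' (by simpa using hc) with
    h | ⟨q', hq', hyq'⟩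
  · exact h.symm.mono (by omega)
  rw [Walk.support_reverse, List.mem_reverse] at hq'
  refine ((hxq.trans (Walk.IsGeodesic.linked hp hc hq hq')).trans hyq'.symm).mono ?_
  have h1 : K.dist x q ≤ M := by
    obtain ⟨r, hr, -⟩ := hxq
    exact (dist_le r).trans hr
  have h2 : K.dist y q' ≤ M := by
    obtain ⟨r, hr, -⟩ := hyq'
    exact (dist_le r).trans hr
  have hcx : K.dist c x = 1 := dist_eq_one_iff_adj.2 hx.1
  have hcy : K.dist c y = 1 := dist_eq_one_iff_adj.2 hy.1
  have h3 := hconn.dist_triangle (u := q) (v := x) (w := q')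
  have h4 := hconn.dist_triangle (u := x) (v := c) (w := q')
  have h5 := hconn.dist_triangle (u := c) (v := y) (w := q')
  have h6 := dist_comm (G := K) (u := q) (v := x)
  have h7 := dist_comm (G := K) (u := x) (v := c)
  omega

theorem IsFirstStep.ne {c v x : V} (h : K.IsFirstStep c v x) : v ≠ c := by
  rintro rfl
  have := h.2
  simp at this

theorem Connected.exists_isFirstStep (hconn : K.Connected) {c v : V} (h : v ≠ c) :
    ∃ x, K.IsFirstStep c v x := by
  obtain ⟨p, hp⟩ := hconn.exists_walk_length_eq_dist c v
  cases p with
  | nil => exact absurd rfl h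
  | cons hadj q =>
    rename_i x
    refine ⟨x, hadj, ?_⟩
    rw [Walk.length_cons] at hp
    have h1 := dist_le q
    have h2 := hconn.dist_triangle (u := c) (v := x) (w := v)
    rw [dist_eq_one_iff_adj.2 hadj] at h2
    omega

/-- A first step towards a vertex `v` on the way to `w` is a first step towards `w`. -/
theorem IsFirstStep.of_dist_eq (hconn : K.Connected) {c v w x : V} (h : K.IsFirstStep c v x)
    (hvw : K.dist c w = K.dist c v + K.dist v w) : K.IsFirstStep c w x := by
  refine ⟨h.1, ?_⟩
  have h1 := hconn.dist_triangle (u := x) (v := v) (w := w)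
  have h2 := hconn.dist_triangle (u := c) (v := x) (w := w)
  have h3 := h.2
  rw [dist_eq_one_iff_adj.2 h.1] at h2
  omega

theorem Connected.dist_map_iso (hconn : K.Connected) (f : K ≃g K) (x y : V) :
    K.dist (f x) (f y) = K.dist x y := by
  have key : ∀ (f : K ≃g K) (x y : V), K.dist (f x) (f y) ≤ K.dist x y := by
    intro f x y
    obtain ⟨p, hp⟩ := hconn.exists_walk_length_eq_dist x y
    have h := dist_le (p.map f.toHom)
    rw [Walk.length_map, hp] at h
    exact h
  refine le_antisymm (key f x y) ?_
  have h := key f.symm (f x) (f y)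
  rwa [RelIso.symm_apply_apply, RelIso.symm_apply_apply] at h

theorem Linked.map_iso {c x y : V} {L : ℕ} (h : K.Linked c L x y) (f : K ≃g K) :
    K.Linked (f c) L (f x) (f y) := by
  obtain ⟨p, hp, hc⟩ := h
  refine ⟨p.map f.toHom, by rwa [Walk.length_map], ?_⟩
  rw [Walk.support_map, List.mem_map]
  rintro ⟨z, hz, hzc⟩
  exact hc (f.injective hzc ▸ hz)

theorem IsFirstStep.map_iso (hconn : K.Connected) {c v x : V} (h : K.IsFirstStep c v x)
    (f : K ≃g K) : K.IsFirstStep (f c) (f v) (f x) := by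
  refine ⟨f.map_adj_iff.2 h.1, ?_⟩
  rw [hconn.dist_map_iso, hconn.dist_map_iso, h.2]

end SimpleGraph

/-! ### The action on the coned-off graph -/

section ConedOffAction

open SimpleGraph

variable {G : Type*} [Group G]

/-- Left translation by `g`, as an automorphism of the coned-off graph. -/
def conedOffTranslation (S : Set G) (𝒢 : Set (Subgroup G)) (g : G) :
    conedOffGraph S 𝒢 ≃g conedOffGraph S 𝒢 where
  toEquiv := (Equiv.mulLeft g).sumCongr (Equiv.sigmaCongrRight fun _ => MulAction.toPerm g)
  map_rel_iff' := by
    have hcoset : ∀ (x : G) (d : Σ H : 𝒢, G ⧸ (H : Subgroup G)),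
        ((g * x : G) : G ⧸ (d.1 : Subgroup G)) = g • d.2 ↔
          (x : G ⧸ (d.1 : Subgroup G)) = d.2 := by
      intro x d
      rw [← smul_eq_mul, ← MulAction.Quotient.smul_coe]
      exact smul_left_cancel_iff g
    rintro (x | d) (y | e)
    · exact mulCayley_adj_mul_iff_right
    · exact hcoset x e
    · exact hcoset y d
    · exact Iff.rfl

/-- The vertex of the coned-off graph given by the coset `H` of `1`. -/
def coneVertex {𝒢 : Set (Subgroup G)} {H : Subgroup G} (hH : H ∈ 𝒢) : ConedOffVertex 𝒢 :=
  .inr ⟨⟨H, hH⟩, ((1 : G) : G ⧸ H)⟩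

variable {S : Set G} {𝒢 : Set (Subgroup G)} {H : Subgroup G} (hH : H ∈ 𝒢)

theorem conedOffTranslation_inl (g x : G) :
    conedOffTranslation S 𝒢 g (.inl x) = .inl (g * x) := rfl

theorem conedOffTranslation_coneVertex (g : G) :
    conedOffTranslation S 𝒢 g (coneVertex hH) = .inr ⟨⟨H, hH⟩, (g : G ⧸ H)⟩ := by
  change (Sum.inr ⟨⟨H, hH⟩, g • ((1 : G) : G ⧸ H)⟩ : ConedOffVertex 𝒢) = _
  rw [MulAction.Quotient.smul_coe, smul_eq_mul, mul_one]

theorem conedOffTranslation_mul (g h : G) (v : ConedOffVertex 𝒢) :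
    conedOffTranslation S 𝒢 (g * h) v =
      conedOffTranslation S 𝒢 g (conedOffTranslation S 𝒢 h v) := by
  rcases v with x | ⟨d, q⟩
  · simp [conedOffTranslation_inl, mul_assoc]
  · change (Sum.inr ⟨d, (g * h) • q⟩ : ConedOffVertex 𝒢) = Sum.inr ⟨d, g • h • q⟩
    rw [mul_smul]

theorem conedOffTranslation_coneVertex_eq_iff {g h : G} :
    conedOffTranslation S 𝒢 g (coneVertex hH) = conedOffTranslation S 𝒢 h (coneVertex hH) ↔
      g⁻¹ * h ∈ H := by
  rw [conedOffTranslation_coneVertex, conedOffTranslation_coneVertex, ← QuotientGroup.eq]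
  simp

theorem conedOffTranslation_coneVertex_eq_self_iff {g : G} :
    conedOffTranslation S 𝒢 g (coneVertex hH) = coneVertex hH ↔ g ∈ H := by
  have h := conedOffTranslation_coneVertex_eq_iff (S := S) hH (g := g) (h := 1)
  rw [conedOffTranslation_coneVertex hH 1, mul_one, inv_mem_iff] at h
  exact h

theorem conedOffGraph_adj_coneVertex_iff {v : ConedOffVertex 𝒢} :
    (conedOffGraph S 𝒢).Adj (coneVertex hH) v ↔ ∃ h ∈ H, v = .inl h := by
  rcases v with x | d
  · change ((x : G ⧸ H) = ((1 : G) : G ⧸ H)) ↔ _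
    rw [eq_comm, QuotientGroup.eq]
    simp
  · exact ⟨fun h => h.elim, by rintro ⟨_, _, h⟩; cases h⟩

/-- The set of elements `g` such that some geodesic from the vertex `H` of the coned-off graph to
the vertex `gH` starts with an edge to an element of `F`. -/
def departureSet (S : Set G) (hH : H ∈ 𝒢) (F : Set G) : Set G :=
  {g | ∃ h ∈ F, (conedOffGraph S 𝒢).IsFirstStep (coneVertex hH)
    (conedOffTranslation S 𝒢 g (coneVertex hH)) (.inl h)}

variable (H) in
/-- A set `E` of elements of `G` is displaced by `H` if it has infinitely many pairwise disjoint
conjugates by elements of `H`. -/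
def IsDisplacedBy (E : Set G) : Prop :=
  ∃ k : ℕ → G, (∀ i, k i ∈ H) ∧
    Pairwise fun i j => Disjoint {g | (k i)⁻¹ * g * k i ∈ E} {g | (k j)⁻¹ * g * k j ∈ E}

theorem IsDisplacedBy.inv {E : Set G} (hE : IsDisplacedBy H E) : IsDisplacedBy H E⁻¹ := by
  obtain ⟨k, hk, hd⟩ := hE
  refine ⟨k, hk, fun i j hij => Set.disjoint_left.2 fun g hi hj => ?_⟩
  refine (Set.disjoint_left.1 (hd hij) : ∀ ⦃a⦄, _) (a := g⁻¹) ?_ ?_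
  · simpa [mul_assoc] using hi
  · simpa [mul_assoc] using hj

/-- Fineness at the vertex `H`, whose neighbours are the elements of `H`. -/
theorem finite_linked_inl (hfine : (conedOffGraph S 𝒢).IsFine) (L : ℕ) {f : G} (hf : f ∈ H) :
    {h | h ∈ H ∧ (conedOffGraph S 𝒢).Linked (coneVertex hH) L (.inl f) (.inl h)}.Finite := by
  have h := hfine.finite_linked ((conedOffGraph_adj_coneVertex_iff hH).2 ⟨f, hf, rfl⟩) L
  refine (h.preimage (Sum.inl_injective.injOn)).subset fun x hx => ?_
  exact ⟨(conedOffGraph_adj_coneVertex_iff hH).2 ⟨x, hx.1, rfl⟩, hx.2⟩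

/-- Elements of `H` translate a finite set of edges at the vertex `H` off itself, up to a bounded
angle, so that `departureSet S hH F` has disjoint conjugates. -/
theorem isDisplacedBy_departureSet (hfine : (conedOffGraph S 𝒢).IsFine)
    (hhyp : (conedOffGraph S 𝒢).IsHyperbolic) (hinf : Infinite H) {F : Set G} (hF : F.Finite)
    (hFH : F ⊆ H) : IsDisplacedBy H (departureSet S hH F) := by
  classical
  have hconn := hhyp.1
  obtain ⟨L, hL⟩ := hhyp.exists_linked_or_dist_eq
  set c := coneVertex hH
  let T := conedOffTranslation S 𝒢
  have hTc : ∀ {k}, k ∈ H → T k c = c := fun hk =>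
    (conedOffTranslation_coneVertex_eq_self_iff hH).2 hk
  set W := ⋃ f ∈ F, {h | h ∈ H ∧ (conedOffGraph S 𝒢).Linked c L (.inl f) (.inl h)} with hW
  have hWfin : W.Finite := hF.biUnion fun f hf => finite_linked_inl hH hfine L (hFH hf)
  have hbad : ((fun p : G × G => p.1 * p.2⁻¹) '' (W ×ˢ F)).Finite := (hWfin.prod hF).image _
  refine exists_seq_of_forall_finset_exists' (fun k => k ∈ H)
    (fun k l => Disjoint {g | k⁻¹ * g * k ∈ departureSet S hH F}
      {g | l⁻¹ * g * l ∈ departureSet S hH F}) ?_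
  intro s hs
  have hfin : (⋃ x ∈ s, (fun b => x * b) '' ((fun p : G × G => p.1 * p.2⁻¹) '' (W ×ˢ F))).Finite :=
    s.finite_toSet.biUnion fun x _ => hbad.image _
  obtain ⟨y, hyH, hy⟩ := ((Set.infinite_coe_iff.1 hinf).sdiff hfin).nonempty
  refine ⟨y, hyH, fun x hx => Set.disjoint_left.2 ?_⟩
  rintro g ⟨f, hf, hgx⟩ ⟨f', hf', hgy⟩
  have step : ∀ {k f : G}, k ∈ H → (conedOffGraph S 𝒢).IsFirstStep c (T (k⁻¹ * g * k) c) (.inl f) →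
      (conedOffGraph S 𝒢).IsFirstStep c (T g c) (.inl (k * f)) := by
    intro k f hk h
    have h' := h.map_iso hconn (T k)
    rw [← conedOffTranslation_mul, hTc hk, conedOffTranslation_inl] at h'
    have e : k * (k⁻¹ * g * k) = g * k := by group
    rw [e] at h'
    have e2 : T (g * k) c = T g c := by rw [conedOffTranslation_mul, hTc hk]
    rwa [← e2]
  have h1 := step (hs x hx) hgx
  have h2 := step hyH hgy
  rcases hL _ _ _ _ _ h1 h2 with h | h
  · apply hy
    simp only [Set.mem_iUnion]
    refine ⟨x, hx, x⁻¹ * y, ⟨⟨x⁻¹ * y * f', f'⟩, ⟨?_, hf'⟩, by simp⟩, by simp⟩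
    rw [hW]
    simp only [Set.mem_iUnion]
    have hxi := inv_mem (hs x hx)
    refine ⟨f, hf, mul_mem (mul_mem hxi hyH) (hFH hf'), ?_⟩
    have h' := h.map_iso (T x⁻¹)
    rw [hTc hxi, conedOffTranslation_inl, conedOffTranslation_inl] at h'
    simpa [mul_assoc] using h'
  · have h3 := hconn.pos_dist_of_ne h1.ne
    rw [SimpleGraph.dist_self] at h
    omega

/-- For `a, b ∉ H` and any `t`, the elements `t` and `s = a⁻¹ t b` cannot both leave `H` and return
to it far from `1`: a geodesic from `H` to `asH = tbH` would then start at a bounded angle from the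
edge towards `aH`, and also like a geodesic from `H` to `tH`. -/
theorem IsHyperbolicRelativeTo.exists_isDisplacedBy (hG : IsHyperbolicRelativeTo 𝒢) (hH : H ∈ 𝒢)
    (hinf : Infinite H) {a b : G} (ha : a ∉ H) (hb : b ∉ H) :
    ∃ D E : Set G, D.Finite ∧ IsDisplacedBy H E ∧
      ∀ t, t ∈ D ∪ (E ∪ E⁻¹) ∨ a⁻¹ * t * b ∈ D ∪ (E ∪ E⁻¹) := by
  obtain ⟨S, -, -, hfine, hhyp⟩ := hG
  have hconn := hhyp.1
  obtain ⟨L, hL⟩ := hhyp.exists_linked_or_dist_eq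
  set K := conedOffGraph S 𝒢
  set c : ConedOffVertex 𝒢 := coneVertex hH
  let T := conedOffTranslation S 𝒢
  have hdist : ∀ g x y, K.dist (T g x) (T g y) = K.dist x y := fun g x y =>
    hconn.dist_map_iso (T g) x y
  have hmul : ∀ g h v, T (g * h) v = T g (T h v) := conedOffTranslation_mul
  have hone : ∀ v, T 1 v = v := by
    intro v
    apply (T 1).injective
    rw [← hmul, one_mul]
  have hTc : ∀ {k}, T k c = c ↔ k ∈ H := conedOffTranslation_coneVertex_eq_self_iff hH
  have hstep : ∀ {g}, g ∉ H → ∃ h ∈ H, K.IsFirstStep c (T g c) (.inl h) := by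
    intro g hg
    obtain ⟨x, hx⟩ := hconn.exists_isFirstStep (c := c) (v := T g c) (fun h => hg (hTc.1 h))
    obtain ⟨h, hh, rfl⟩ := (conedOffGraph_adj_coneVertex_iff hH).1 hx.1
    exact ⟨h, hh, hx⟩
  obtain ⟨ha₁, hha₁, hsa⟩ := hstep ha
  obtain ⟨ha₂, hha₂, hsa'⟩ := hstep (g := a⁻¹) (by simpa using ha)
  obtain ⟨hb₁, hhb₁, hsb⟩ := hstep hb
  let lk : G → Set G := fun f => {h | h ∈ H ∧ K.Linked c L (.inl f) (.inl h)}
  have hlk : ∀ {f}, f ∈ H → (lk f).Finite := fun hf => finite_linked_inl hH hfine L hf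
  set F := lk ha₁ ∪ lk ha₂ ∪ lk hb₁
  have hF : F.Finite := ((hlk hha₁).union (hlk hha₂)).union (hlk hhb₁)
  have hFH : F ⊆ H := by
    rintro x ((hx | hx) | hx) <;> exact hx.1
  set E := departureSet S hH F
  refine ⟨(fun x => x * hb₁⁻¹) '' lk ha₁, E, (hlk hha₁).image _,
    isDisplacedBy_departureSet hH hfine hhyp hinf hF hFH, fun t => ?_⟩
  by_contra! hcon
  obtain ⟨ht, hs⟩ := hcon
  simp only [Set.mem_union, not_or] at ht hs
  obtain ⟨htD, htE, htE'⟩ := ht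
  obtain ⟨-, hsE, -⟩ := hs
  set s := a⁻¹ * t * b with hsdef
  have hast : a * s = t * b := by rw [hsdef]; group
  -- A geodesic from `c` to `tbc = asc` may be taken to pass through `ac`.
  have h1 : K.IsFirstStep c (T (t * b) c) (.inl ha₁) := by
    rw [← hast, hmul]
    by_cases hsH : s ∈ H
    · rwa [hTc.2 hsH]
    obtain ⟨hs₁, hhs₁, hss⟩ := hstep hsH
    refine hsa.of_dist_eq hconn ?_
    rcases hL _ _ _ _ _ hsa' hss with h | h
    · exact absurd ⟨hs₁, Or.inl (Or.inr ⟨hhs₁, h⟩), hss⟩ hsE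
    · rw [← hdist a, ← hmul, mul_inv_cancel, hone] at h
      rw [h, ← hdist a (T a⁻¹ c) c, ← hmul, mul_inv_cancel, hone, hdist]
  by_cases htH : t ∈ H
  · -- Then `t hb₁` is a first step towards `tbc`, so `t` lies in the finite set.
    have h2 := hsb.map_iso hconn (T t)
    rw [hTc.2 htH, ← hmul] at h2
    rcases hL _ _ _ _ _ h1 h2 with h | h
    · exact htD ⟨t * hb₁, ⟨mul_mem htH hhb₁, h⟩, by simp⟩
    · have h3 := hconn.pos_dist_of_ne h1.ne
      rw [SimpleGraph.dist_self] at h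
      omega
  · -- Otherwise a geodesic from `c` to `tbc` may be taken to pass through `tc`.
    obtain ⟨ht₁, hht₁, hts⟩ := hstep htH
    obtain ⟨ht₂, hht₂, hts'⟩ := hstep (g := t⁻¹) (by simpa using htH)
    have h2 : K.IsFirstStep c (T (t * b) c) (.inl ht₁) := by
      refine hts.of_dist_eq hconn ?_
      rcases hL _ _ _ _ _ hsb hts' with h | h
      · exact absurd ⟨ht₂, Or.inr ⟨hht₂, h⟩, hts'⟩ htE'
      · have e1 : K.dist c (T t⁻¹ c) = K.dist c (T t c) := by
          rw [← hdist t, ← hmul, mul_inv_cancel, hone, SimpleGraph.dist_comm]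
        have e2 : K.dist (T t c) (T (t * b) c) = K.dist c (T b c) := by rw [hmul, hdist]
        have e3 : K.dist (T b c) (T t⁻¹ c) = K.dist c (T (t * b) c) := by
          rw [← hdist t, ← hmul, ← hmul, mul_inv_cancel, hone, SimpleGraph.dist_comm]
        rw [e2, ← e3, h, e1, SimpleGraph.dist_comm, add_comm]
    rcases hL _ _ _ _ _ h1 h2 with h | h
    · exact htE ⟨ht₁, Or.inl (Or.inl ⟨hht₁, h⟩), hts⟩
    · have h3 := hconn.pos_dist_of_ne h1.ne
      rw [SimpleGraph.dist_self] at h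
      omega

end ConedOffAction

/-! ### Regular representations and coefficients -/

section RegularRepresentation

variable {G : Type*}

open Classical in
/-- The canonical basis vector `δ_g` of `ℓ²(G)`. -/
noncomputable def basisVector (g : G) : EllTwo G :=
  lp.single 2 g (1 : ℂ)

open Classical in
theorem basisVector_apply (g k : G) : basisVector g k = if k = g then (1 : ℂ) else 0 := by
  rw [basisVector, lp.single_apply, Pi.single_apply]

theorem inner_basisVector_left (g : G) (f : EllTwo G) : ⟪basisVector g, f⟫_ℂ = f g := by
  classical
  rw [basisVector, lp.inner_single_left]
  simp

theorem norm_basisVector (g : G) : ‖basisVector g‖ = 1 := by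
  classical
  rw [basisVector, lp.norm_single (by norm_num), norm_one]

theorem hasSum_smul_basisVector (f : EllTwo G) : HasSum (fun g => f g • basisVector g) f := by
  classical
  have h := lp.hasSum_single (p := 2) (by simp) f
  convert h using 2 with g
  rw [basisVector, ← lp.single_smul, smul_eq_mul, mul_one]

theorem hasSum_norm_sq (f : EllTwo G) : HasSum (fun g => ‖f g‖ ^ 2) (‖f‖ ^ 2) := by
  have h := lp.hasSum_norm (p := 2) (by simp) f
  simpa using h

theorem norm_eq_of_equiv {f f' : EllTwo G} (e : G ≃ G) (h : ∀ g, ‖f' g‖ = ‖f (e g)‖) :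
    ‖f'‖ = ‖f‖ := by
  have h2 : ‖f'‖ ^ 2 = ‖f‖ ^ 2 := by
    refine (hasSum_norm_sq f').unique ?_
    have h3 := e.hasSum_iff.2 (hasSum_norm_sq f)
    convert h3 using 2 with g
    rw [h g]
    rfl
  exact (sq_eq_sq₀ (norm_nonneg _) (norm_nonneg _)).1 h2

theorem clm_ext_basisVector {A B : EllTwo G →L[ℂ] EllTwo G}
    (h : ∀ g, A (basisVector g) = B (basisVector g)) : A = B := by
  ext1 f
  have hA := (hasSum_smul_basisVector f).mapL A
  have hB := (hasSum_smul_basisVector f).mapL B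
  simp only [map_smul, h] at hA hB
  exact hA.unique hB

variable [Group G]

theorem memlp_translate_right (g : G) (f : EllTwo G) : Memℓp (fun x : G => f (x * g)) 2 := by
  have h := (memℓp_gen_iff (p := 2) (by simp)).1 f.2
  exact (memℓp_gen_iff (p := 2) (by simp)).2 ((Equiv.mulRight g).summable_iff.2 h)

/-- The right regular representation: the unitary with `(ρ_g f)(x) = f(x g)`. -/
noncomputable def rightRegular (g : G) : EllTwo G →ₗᵢ[ℂ] EllTwo G where
  toFun f := ⟨fun x => f (x * g), memlp_translate_right g f⟩
  map_add' _ _ := rfl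
  map_smul' _ _ := rfl
  norm_map' _ := norm_eq_of_equiv (Equiv.mulRight g) fun _ => rfl

theorem leftRegular_apply (g : G) (f : EllTwo G) (k : G) : leftRegular g f k = f (g⁻¹ * k) := rfl

theorem rightRegular_apply (g : G) (f : EllTwo G) (k : G) : rightRegular g f k = f (k * g) := rfl

theorem leftRegular_basisVector (g h : G) :
    leftRegular g (basisVector h) = basisVector (g * h) := by
  classical
  ext k
  rw [leftRegular_apply, basisVector_apply, basisVector_apply]
  simp [inv_mul_eq_iff_eq_mul]

theorem rightRegular_basisVector (g h : G) :
    rightRegular g (basisVector h) = basisVector (h * g⁻¹) := by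
  classical
  ext k
  rw [rightRegular_apply, basisVector_apply, basisVector_apply]
  simp [eq_mul_inv_iff_mul_eq]

/-- The unitary `u_g` as a bounded operator. -/
noncomputable abbrev leftUnitary (g : G) : EllTwo G →L[ℂ] EllTwo G :=
  (leftRegular g).toContinuousLinearMap

theorem star_leftUnitary (g : G) : star (leftUnitary g) = leftUnitary g⁻¹ := by
  rw [ContinuousLinearMap.star_eq_adjoint]
  symm
  rw [ContinuousLinearMap.eq_adjoint_iff]
  intro x y
  have h := (leftRegular g).inner_map_map (leftRegular g⁻¹ x) y
  have h' : leftRegular g (leftRegular g⁻¹ x) = x := by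
    ext k
    simp [leftRegular_apply]
  rw [h'] at h
  exact h.symm

theorem mem_groupVN_iff {H : Subgroup G} {x : EllTwo G →L[ℂ] EllTwo G} :
    x ∈ groupVN H ↔ ∀ T : EllTwo G →L[ℂ] EllTwo G,
      (∀ h ∈ H, leftUnitary h * T = T * leftUnitary h) → T * x = x * T := by
  have hcomm : ∀ T : EllTwo G →L[ℂ] EllTwo G,
      T ∈ StarSubalgebra.centralizer ℂ {T | ∃ h ∈ H, T = leftUnitary h} ↔
        ∀ h ∈ H, leftUnitary h * T = T * leftUnitary h := by
    intro T
    rw [StarSubalgebra.mem_centralizer_iff]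
    constructor
    · exact fun h k hk => (h _ ⟨k, hk, rfl⟩).1
    · rintro h _ ⟨k, hk, rfl⟩
      refine ⟨h k hk, ?_⟩
      rw [star_leftUnitary]
      exact h _ (inv_mem hk)
  have hx : x ∈ groupVN H ↔ x ∈ StarSubalgebra.centralizer ℂ
      (StarSubalgebra.centralizer ℂ {T | ∃ h ∈ H, T = leftUnitary h} :
        Set (EllTwo G →L[ℂ] EllTwo G)) := Iff.rfl
  rw [hx, StarSubalgebra.mem_centralizer_iff]
  constructor
  · exact fun h T hT => (h T ((hcomm T).2 hT)).1
  · intro h T hT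
    exact ⟨h T ((hcomm T).1 hT), h _ ((hcomm _).1 (star_mem hT))⟩

theorem leftUnitary_mem_groupVN {H : Subgroup G} {h : G} (hh : h ∈ H) :
    leftUnitary h ∈ groupVN H :=
  mem_groupVN_iff.2 fun _ hT => (hT h hh).symm

variable {x y u : EllTwo G →L[ℂ] EllTwo G}

theorem apply_rightRegular (hx : x ∈ groupVN (⊤ : Subgroup G)) (g : G) (f : EllTwo G) :
    x (rightRegular g f) = rightRegular g (x f) := by
  have h := mem_groupVN_iff.1 hx (rightRegular g).toContinuousLinearMap fun k _ => by
    ext f l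
    change f (k⁻¹ * l * g) = f (k⁻¹ * (l * g))
    rw [mul_assoc]
  exact (congrArg (fun T : EllTwo G →L[ℂ] EllTwo G => T f) h).symm

theorem apply_basisVector (hx : x ∈ groupVN (⊤ : Subgroup G)) (g : G) :
    x (basisVector g) = rightRegular g⁻¹ (x (basisVector 1)) := by
  rw [← apply_rightRegular hx, rightRegular_basisVector, inv_inv, one_mul]

theorem star_apply_basisVector_one (hx : x ∈ groupVN (⊤ : Subgroup G)) (g : G) :
    (star x) (basisVector 1) g = starRingEnd ℂ (x (basisVector 1) g⁻¹) := by
  rw [← inner_basisVector_left, ContinuousLinearMap.star_eq_adjoint,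
    ContinuousLinearMap.adjoint_inner_right, apply_basisVector hx, ← inner_conj_symm,
    inner_basisVector_left, rightRegular_apply, one_mul]

theorem norm_star_apply_basisVector_one (hx : x ∈ groupVN (⊤ : Subgroup G)) :
    ‖(star x) (basisVector 1)‖ = ‖x (basisVector 1)‖ :=
  norm_eq_of_equiv (Equiv.inv G) fun g => by
    rw [star_apply_basisVector_one hx, RCLike.norm_conj]
    rfl

/-- Right multiplication by a unitary preserves the `2`-norm, because `τ` is a trace. -/
theorem norm_mul_unitary_apply (hx : x ∈ groupVN (⊤ : Subgroup G))
    (hu : u ∈ groupVN (⊤ : Subgroup G)) (huu : u ∈ unitary (EllTwo G →L[ℂ] EllTwo G)) :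
    ‖x (u (basisVector 1))‖ = ‖x (basisVector 1)‖ := by
  rw [← mul_apply_eq_comp, ← norm_star_apply_basisVector_one (mul_mem hx hu), star_mul,
    mul_apply_eq_comp, ContinuousLinearMap.norm_map_of_mem_unitary (Unitary.star_mem huu),
    norm_star_apply_basisVector_one hx]

theorem traceTwoNorm_groupTrace (x : EllTwo G →L[ℂ] EllTwo G) :
    traceTwoNorm (groupTrace G) x = ‖x (basisVector 1)‖ := by
  have h : groupTrace G (star x * x) = ⟪x (basisVector 1), x (basisVector 1)⟫_ℂ := by
    change ⟪basisVector 1, (star x * x) (basisVector 1)⟫_ℂ = _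
    rw [mul_apply_eq_comp, ContinuousLinearMap.star_eq_adjoint,
      ContinuousLinearMap.adjoint_inner_right]
  rw [traceTwoNorm, h, @norm_eq_sqrt_re_inner ℂ]
  rfl

/-- An element of `LG` whose Fourier coefficients are supported on `H` belongs to `LH`: its matrix
coefficients against those of an operator commuting with `u_h`, `h ∈ H`, can be compared term by
term. -/
theorem mem_groupVN_of_support {H : Subgroup G} (hx : x ∈ groupVN (⊤ : Subgroup G))
    (hsupp : ∀ g, g ∉ H → x (basisVector 1) g = 0) : x ∈ groupVN H := by
  rw [mem_groupVN_iff]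
  intro T hT
  refine clm_ext_basisVector fun s => ?_
  ext t
  have h1 : (T * x) (basisVector s) t =
      ∑' g, x (basisVector 1) g * T (basisVector (g * s)) t := by
    rw [← inner_basisVector_left, mul_apply_eq_comp,
      ← ContinuousLinearMap.adjoint_inner_left, lp.inner_eq_tsum,
      ← (Equiv.mulRight s).tsum_eq]
    refine tsum_congr fun g => ?_
    rw [apply_basisVector hx, Equiv.coe_mulRight, rightRegular_apply, mul_inv_cancel_right,
      RCLike.inner_apply]
    congr 1
    rw [← inner_basisVector_left, inner_conj_symm, ContinuousLinearMap.adjoint_inner_left,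
      inner_basisVector_left]
  have h2 : (x * T) (basisVector s) t =
      ∑' g, x (basisVector 1) g * T (basisVector s) (g⁻¹ * t) := by
    rw [← inner_basisVector_left, mul_apply_eq_comp,
      ← ContinuousLinearMap.adjoint_inner_left, lp.inner_eq_tsum,
      ← ((Equiv.inv G).trans (Equiv.mulRight t)).tsum_eq]
    refine tsum_congr fun g => ?_
    rw [← ContinuousLinearMap.star_eq_adjoint, apply_basisVector (star_mem hx),
      rightRegular_apply, star_apply_basisVector_one hx, RCLike.inner_apply]
    simp [mul_comm]
  rw [h1, h2]
  refine tsum_congr fun g => ?_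
  by_cases hg : g ∈ H
  · rw [← leftRegular_basisVector]
    have h3 := congrArg (fun A : EllTwo G →L[ℂ] EllTwo G => A (basisVector s) t) (hT g hg)
    change leftRegular g (T (basisVector s)) t = T (leftRegular g (basisVector s)) t at h3
    rw [← h3, leftRegular_apply]
  · rw [hsupp g hg, zero_mul, zero_mul]

end RegularRepresentation

/-! ### Mass of a vector of `ℓ²(G)` on a subset -/

section Restriction

variable {G : Type*}

/-- The vector `f` cut off outside the set `B`. -/
noncomputable def restrictTo (B : Set G) (f : EllTwo G) : EllTwo G :=
  ⟨B.indicator f, by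
    refine (memℓp_gen_iff (p := 2) (by simp)).2 ?_
    refine Summable.of_nonneg_of_le (fun _ => by positivity) (fun k => ?_)
      ((memℓp_gen_iff (p := 2) (by simp)).1 f.2)
    gcongr
    exact norm_indicator_le_norm_self _ _⟩

theorem restrictTo_apply (B : Set G) (f : EllTwo G) (k : G) :
    restrictTo B f k = B.indicator f k := rfl

theorem restrictTo_sub (B : Set G) (f g : EllTwo G) :
    restrictTo B (f - g) = restrictTo B f - restrictTo B g := by
  ext k
  exact congrFun (Set.indicator_sub B f g) k

theorem restrictTo_add_restrictTo_compl (B : Set G) (f : EllTwo G) :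
    restrictTo B f + restrictTo Bᶜ f = f := by
  ext k
  exact congrFun (Set.indicator_self_add_compl B f) k

theorem hasSum_norm_restrictTo_sq (B : Set G) (f : EllTwo G) :
    HasSum (B.indicator fun k => ‖f k‖ ^ 2) (‖restrictTo B f‖ ^ 2) := by
  convert hasSum_norm_sq (restrictTo B f) using 2 with k
  rw [restrictTo_apply]
  by_cases hk : k ∈ B <;> simp [hk]

theorem norm_restrictTo_le (B : Set G) (f : EllTwo G) : ‖restrictTo B f‖ ≤ ‖f‖ := by
  refine (sq_le_sq₀ (norm_nonneg _) (norm_nonneg _)).1 ?_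
  exact hasSum_le (fun k => Set.indicator_le_self' (fun _ _ => by positivity) k)
    (hasSum_norm_restrictTo_sq B f) (hasSum_norm_sq f)

theorem norm_restrictTo_union_le (A B : Set G) (f : EllTwo G) :
    ‖restrictTo (A ∪ B) f‖ ≤ ‖restrictTo A f‖ + ‖restrictTo B f‖ := by
  have h : ‖restrictTo (A ∪ B) f‖ ^ 2 ≤ ‖restrictTo A f‖ ^ 2 + ‖restrictTo B f‖ ^ 2 := by
    refine hasSum_le (fun k => ?_) (hasSum_norm_restrictTo_sq _ f)
      ((hasSum_norm_restrictTo_sq A f).add (hasSum_norm_restrictTo_sq B f))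
    by_cases hA : k ∈ A <;> by_cases hB : k ∈ B <;> simp [hA, hB]
  nlinarith [norm_nonneg (restrictTo (A ∪ B) f), norm_nonneg (restrictTo A f),
    norm_nonneg (restrictTo B f), mul_nonneg (norm_nonneg (restrictTo A f))
    (norm_nonneg (restrictTo B f))]

theorem sum_norm_restrictTo_sq_le {ι : Type*} (s : Finset ι) {E : ι → Set G}
    (hE : Pairwise fun i j => Disjoint (E i) (E j)) (f : EllTwo G) :
    ∑ i ∈ s, ‖restrictTo (E i) f‖ ^ 2 ≤ ‖f‖ ^ 2 := by
  refine hasSum_le (fun k => ?_) (hasSum_sum fun i _ => hasSum_norm_restrictTo_sq (E i) f)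
    (hasSum_norm_sq f)
  have h := congrFun (Finset.indicator_biUnion s E (f := fun k => ‖f k‖ ^ 2)
    fun i _ j _ hij => hE hij) k
  refine h.symm.le.trans ?_
  exact Set.indicator_le_self' (fun _ _ => by positivity) k

/-- The mass of a weakly null sequence on a finite set tends to `0`. -/
theorem tendsto_norm_restrictTo_of_finite {f : ℕ → EllTwo G}
    (hf : ∀ g, Tendsto (fun n => f n g) atTop (𝓝 0)) {D : Set G} (hD : D.Finite) :
    Tendsto (fun n => ‖restrictTo D (f n)‖) atTop (𝓝 0) := by
  have h : ∀ n, ‖restrictTo D (f n)‖ ^ 2 = ∑ k ∈ hD.toFinset, ‖f n k‖ ^ 2 := by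
    intro n
    refine (hasSum_norm_restrictTo_sq D (f n)).unique ?_
    have h1 : HasSum (D.indicator fun k => ‖f n k‖ ^ 2)
        (∑ k ∈ hD.toFinset, D.indicator (fun k => ‖f n k‖ ^ 2) k) :=
      hasSum_sum_of_ne_finset_zero fun k hk => by simpa using fun h => absurd h (by simpa using hk)
    rwa [Finset.sum_congr rfl fun k hk => Set.indicator_of_mem (hD.mem_toFinset.1 hk) _] at h1
  have h2 : Tendsto (fun n => ‖restrictTo D (f n)‖ ^ 2) atTop (𝓝 0) := by
    simp only [h]
    have h3 := tendsto_finsetSum hD.toFinset fun k _ => ((hf k).norm.pow 2)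
    simpa using h3
  have h4 := h2.sqrt
  simpa [Real.sqrt_sq] using h4

variable [Group G]

theorem restrictTo_conj (E : Set G) (k : G) (f : EllTwo G) :
    restrictTo {g | k⁻¹ * g * k ∈ E} (leftRegular k (rightRegular k f)) =
      leftRegular k (rightRegular k (restrictTo E f)) := by
  classical
  ext g
  simp only [restrictTo_apply, leftRegular_apply, rightRegular_apply, Set.indicator_apply]
  rfl

/-- A sequence that is asymptotically invariant under conjugation by `H` has asymptotically no mass
on a set with infinitely many disjoint conjugates by elements of `H`. -/
theorem IsDisplacedBy.tendsto_norm_restrictTo {H : Subgroup G} {E : Set G}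
    (hE : IsDisplacedBy H E) {f : ℕ → EllTwo G} (hf : ∀ n, ‖f n‖ ≤ 1)
    (hconj : ∀ h ∈ H, Tendsto (fun n => ‖leftRegular h (rightRegular h (f n)) - f n‖)
      atTop (𝓝 0)) :
    Tendsto (fun n => ‖restrictTo E (f n)‖) atTop (𝓝 0) := by
  obtain ⟨k, hk, hd⟩ := hE
  rw [Metric.tendsto_atTop']
  intro ε hε
  obtain ⟨N, hN⟩ := exists_nat_gt (1 / (ε / 2) ^ 2)
  have hN' : 1 < N * (ε / 2) ^ 2 := by
    rwa [div_lt_iff₀ (by positivity)] at hN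
  have hev : ∀ᶠ n in atTop, ∀ i ∈ Finset.range N,
      ‖leftRegular (k i) (rightRegular (k i) (f n)) - f n‖ < ε / 2 :=
    (Finset.eventually_all _).2 fun i _ =>
      (hconj (k i) (hk i)).eventually (gt_mem_nhds (by positivity))
  obtain ⟨n₀, hn₀⟩ := eventually_atTop.1 hev
  refine ⟨n₀, fun n hn => ?_⟩
  rw [Real.dist_eq, sub_zero, abs_of_nonneg (norm_nonneg _)]
  by_contra! hge
  have hlow : ∀ i ∈ Finset.range N,
      (ε / 2) ^ 2 ≤ ‖restrictTo {g | (k i)⁻¹ * g * k i ∈ E} (f n)‖ ^ 2 := by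
    intro i hi
    have h1 := hn₀ n hn.le i hi
    have h2 := norm_restrictTo_le {g | (k i)⁻¹ * g * k i ∈ E}
      (leftRegular (k i) (rightRegular (k i) (f n)) - f n)
    rw [restrictTo_sub, restrictTo_conj] at h2
    have h3 := norm_sub_norm_le (leftRegular (k i) (rightRegular (k i) (restrictTo E (f n))))
      (restrictTo {g | (k i)⁻¹ * g * k i ∈ E} (f n))
    rw [LinearIsometry.norm_map, LinearIsometry.norm_map] at h3
    have h4 : ε / 2 ≤ ‖restrictTo {g | (k i)⁻¹ * g * k i ∈ E} (f n)‖ := by linarith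
    gcongr
  have hsum := sum_norm_restrictTo_sq_le (Finset.range N) hd (f n)
  have hlow' := Finset.sum_le_sum hlow
  rw [Finset.sum_const, Finset.card_range, nsmul_eq_mul] at hlow'
  have := hf n
  nlinarith [norm_nonneg (f n)]

/-- Asymptotic orthogonality: if the vectors `f n` are bounded, weakly null and asymptotically
invariant under conjugation by `H`, then left translation by `a ∉ H` makes them asymptotically
orthogonal to their right translates by `b ∉ H`. -/
theorem IsHyperbolicRelativeTo.tendsto_inner_translates {𝒢 : Set (Subgroup G)}
    (hG : IsHyperbolicRelativeTo 𝒢) {H : Subgroup G} (hH : H ∈ 𝒢) (hinf : Infinite H)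
    {f : ℕ → EllTwo G} (hf : ∀ n, ‖f n‖ ≤ 1) (hf0 : ∀ g, Tendsto (fun n => f n g) atTop (𝓝 0))
    (hconj : ∀ h ∈ H, Tendsto (fun n => ‖leftRegular h (rightRegular h (f n)) - f n‖)
      atTop (𝓝 0)) {a b : G} (ha : a ∉ H) (hb : b ∉ H) :
    Tendsto (fun n => ⟪rightRegular b⁻¹ (f n), leftRegular a (f n)⟫_ℂ) atTop (𝓝 0) := by
  obtain ⟨D, E, hD, hE, hcover⟩ := hG.exists_isDisplacedBy hH hinf ha hb
  set B := D ∪ (E ∪ E⁻¹)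
  have hmass : Tendsto (fun n => ‖restrictTo D (f n)‖ +
      (‖restrictTo E (f n)‖ + ‖restrictTo E⁻¹ (f n)‖)) atTop (𝓝 0) := by
    simpa using (tendsto_norm_restrictTo_of_finite hf0 hD).add
      ((hE.tendsto_norm_restrictTo hf hconj).add (hE.inv.tendsto_norm_restrictTo hf hconj))
  have hbound : ∀ n, ‖restrictTo B (f n)‖ ≤ ‖restrictTo D (f n)‖ +
      (‖restrictTo E (f n)‖ + ‖restrictTo E⁻¹ (f n)‖) := fun n =>
    (norm_restrictTo_union_le _ _ _).trans (by gcongr; exact norm_restrictTo_union_le _ _ _)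
  have hB0 : Tendsto (fun n => 2 * ‖restrictTo B (f n)‖) atTop (𝓝 0) := by
    simpa using (squeeze_zero (fun _ => norm_nonneg _) hbound hmass).const_mul 2
  refine squeeze_zero_norm (fun n => ?_) hB0
  -- Off `B` the two translates have disjoint supports.
  have horth : ⟪rightRegular b⁻¹ (restrictTo Bᶜ (f n)), leftRegular a (restrictTo Bᶜ (f n))⟫_ℂ
      = 0 := by
    rw [lp.inner_eq_tsum]
    refine (tsum_congr fun k => ?_).trans tsum_zero
    rw [rightRegular_apply, leftRegular_apply, restrictTo_apply, restrictTo_apply]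
    have h := hcover (k * b⁻¹)
    rw [← mul_assoc, inv_mul_cancel_right] at h
    rcases h with h | h
    · rw [Set.indicator_of_notMem (by simpa using h), inner_zero_left]
    · rw [Set.indicator_of_notMem (a := a⁻¹ * k) (by simpa using h), inner_zero_right]
  have hsplit : ⟪rightRegular b⁻¹ (f n), leftRegular a (f n)⟫_ℂ =
      ⟪rightRegular b⁻¹ (restrictTo B (f n)), leftRegular a (f n)⟫_ℂ +
        ⟪rightRegular b⁻¹ (restrictTo Bᶜ (f n)), leftRegular a (restrictTo B (f n))⟫_ℂ := by
    have h1 : rightRegular b⁻¹ (f n) = rightRegular b⁻¹ (restrictTo B (f n)) +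
        rightRegular b⁻¹ (restrictTo Bᶜ (f n)) := by
      rw [← map_add, restrictTo_add_restrictTo_compl]
    have h2 : leftRegular a (f n) = leftRegular a (restrictTo B (f n)) +
        leftRegular a (restrictTo Bᶜ (f n)) := by
      rw [← map_add, restrictTo_add_restrictTo_compl]
    conv_lhs => rw [h1, inner_add_left]
    congr 1
    rw [h2, inner_add_right, horth, add_zero]
  rw [hsplit]
  have h1 := norm_inner_le_norm (𝕜 := ℂ) (rightRegular b⁻¹ (restrictTo B (f n)))
    (leftRegular a (f n))
  have h2 := norm_inner_le_norm (𝕜 := ℂ) (rightRegular b⁻¹ (restrictTo Bᶜ (f n)))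
    (leftRegular a (restrictTo B (f n)))
  simp only [LinearIsometry.norm_map] at h1 h2
  have h3 := norm_restrictTo_le Bᶜ (f n)
  have h4 := hf n
  have h5 := norm_nonneg (restrictTo B (f n))
  refine (norm_add_le _ _).trans ?_
  nlinarith

end Restriction

/-! ### Maximality -/

section Maximality

variable {G : Type*} [Group G] {H : Subgroup G} {u : EllTwo G →L[ℂ] EllTwo G}

/-- The element `∑ g ∈ A, c g • u_g` of `LG`. -/
noncomputable def finiteCombination (c : G → ℂ) (A : Finset G) : EllTwo G →L[ℂ] EllTwo G :=
  ∑ g ∈ A, c g • leftUnitary g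

theorem finiteCombination_mem (c : G → ℂ) (A : Finset G) :
    finiteCombination c A ∈ groupVN (⊤ : Subgroup G) :=
  sum_mem fun g _ => (groupVN (⊤ : Subgroup G)).toStarSubalgebra.smul_mem
    (leftUnitary_mem_groupVN (Subgroup.mem_top g)) (c g)

theorem finiteCombination_apply (c : G → ℂ) (A : Finset G) (f : EllTwo G) :
    finiteCombination c A f = ∑ g ∈ A, c g • leftRegular g f := by
  simp [finiteCombination]

theorem finiteCombination_apply_basisVector_one (c : G → ℂ) (A : Finset G) :
    finiteCombination c A (basisVector 1) = ∑ g ∈ A, c g • basisVector g := by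
  rw [finiteCombination_apply]
  refine Finset.sum_congr rfl fun g _ => ?_
  rw [leftRegular_basisVector, mul_one]

theorem norm_le_norm_finiteCombination (c : G → ℂ) {A : Finset G} {g : G} (hg : g ∈ A) :
    ‖c g‖ ≤ ‖finiteCombination c A (basisVector 1)‖ := by
  classical
  have h1 : finiteCombination c A (basisVector 1) g = c g := by
    rw [finiteCombination_apply_basisVector_one, ← inner_basisVector_left, inner_sum,
      Finset.sum_eq_single g]
    · rw [inner_smul_right, inner_basisVector_left, basisVector_apply, if_pos rfl, mul_one]
    · intro k _ hk
      rw [inner_smul_right, inner_basisVector_left, basisVector_apply, if_neg hk.symm, mul_zero]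
    · exact fun h => absurd hg h
  rw [← h1]
  exact lp.norm_apply_le_norm (p := 2) (by norm_num) _ g

/-- Every element of `LG` is approximated in `2`-norm by partial sums of its Fourier series. -/
theorem exists_norm_sub_finiteCombination_lt (x : EllTwo G →L[ℂ] EllTwo G) (g₀ : G) {ε : ℝ}
    (hε : 0 < ε) : ∃ A : Finset G, g₀ ∈ A ∧
      ‖(x - finiteCombination (x (basisVector 1)) A) (basisVector 1)‖ < ε := by
  have h2 : Tendsto (fun A => finiteCombination (x (basisVector 1)) A (basisVector 1)) atTop
      (𝓝 (x (basisVector 1))) := by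
    simp only [finiteCombination_apply_basisVector_one]
    exact hasSum_smul_basisVector _
  have h1 : Tendsto (fun A : Finset G =>
      ‖(x - finiteCombination (x (basisVector 1)) A) (basisVector 1)‖) atTop (𝓝 0) := by
    simpa using (h2.const_sub (x (basisVector 1))).norm
  obtain ⟨A, hA, hA'⟩ := ((eventually_ge_atTop {g₀}).and
    (h1.eventually (gt_mem_nhds hε))).exists
  exact ⟨A, by simpa using hA, hA'⟩

theorem norm_commutator_unitary_le {e : EllTwo G →L[ℂ] EllTwo G}
    (he : e ∈ groupVN (⊤ : Subgroup G)) (hu : u ∈ groupVN (⊤ : Subgroup G))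
    (huu : u ∈ unitary (EllTwo G →L[ℂ] EllTwo G)) :
    ‖(e * u - u * e) (basisVector 1)‖ ≤ 2 * ‖e (basisVector 1)‖ := by
  have h := norm_sub_le (e (u (basisVector 1))) (u (e (basisVector 1)))
  rw [norm_mul_unitary_apply he hu huu, ContinuousLinearMap.norm_map_of_mem_unitary huu] at h
  refine h.trans ?_
  rw [two_mul]

/-- `2`-norm commutation of `u` with `u_h` is conjugation invariance of the coefficients of `u`. -/
theorem norm_commutator_leftUnitary (hu : u ∈ groupVN (⊤ : Subgroup G)) (h : G) :
    ‖(leftUnitary h * u - u * leftUnitary h) (basisVector 1)‖ =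
      ‖leftRegular h (rightRegular h (u (basisVector 1))) - u (basisVector 1)‖ := by
  have e : (leftUnitary h * u - u * leftUnitary h) (basisVector 1) =
      leftRegular h (u (basisVector 1)) - rightRegular h⁻¹ (u (basisVector 1)) := by
    change leftRegular h (u (basisVector 1)) - u (leftRegular h (basisVector 1)) = _
    rw [leftRegular_basisVector, mul_one, ← apply_basisVector hu]
  rw [e, ← (rightRegular h).norm_map, map_sub]
  congr 2
  · ext k
    simp only [leftRegular_apply, rightRegular_apply, mul_assoc]
  · ext k
    simp only [rightRegular_apply, mul_inv_cancel_right]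

theorem tendsto_norm_commutator_finiteCombination {u : ℕ → EllTwo G →L[ℂ] EllTwo G}
    (hcomm : ∀ h ∈ H, Tendsto (fun n => ‖(leftUnitary h * u n - u n * leftUnitary h)
      (basisVector 1)‖) atTop (𝓝 0)) (c : G → ℂ) {A : Finset G} (hA : ∀ g ∈ A, g ∈ H) :
    Tendsto (fun n => ‖(finiteCombination c A * u n - u n * finiteCombination c A)
      (basisVector 1)‖) atTop (𝓝 0) := by
  have h1 : ∀ n, (finiteCombination c A * u n - u n * finiteCombination c A) (basisVector 1) =
      ∑ g ∈ A, c g • (leftUnitary g * u n - u n * leftUnitary g) (basisVector 1) := by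
    intro n
    simp only [finiteCombination, Finset.sum_mul, Finset.mul_sum, ← Finset.sum_sub_distrib,
      smul_mul_assoc, mul_smul_comm, ← smul_sub, sum_apply, smul_apply]
  rw [← tendsto_zero_iff_norm_tendsto_zero]
  simp only [h1]
  have h2 := tendsto_finsetSum A fun g hg =>
    (tendsto_zero_iff_norm_tendsto_zero.2 (hcomm g (hA g hg))).const_smul (c g)
  simpa using h2

/-- If the coefficient vectors of the `u n` have asymptotically orthogonal translates off `H`, then
`y u n` and `u n y` are asymptotically orthogonal for finite combinations `y` supported off `H`. -/
theorem tendsto_inner_finiteCombination {u : ℕ → EllTwo G →L[ℂ] EllTwo G}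
    (hu : ∀ n, u n ∈ groupVN (⊤ : Subgroup G))
    (horth : ∀ a b, a ∉ H → b ∉ H → Tendsto (fun n => ⟪rightRegular b⁻¹ (u n (basisVector 1)),
      leftRegular a (u n (basisVector 1))⟫_ℂ) atTop (𝓝 0))
    (c : G → ℂ) {A : Finset G} (hA : ∀ g ∈ A, g ∉ H) :
    Tendsto (fun n => ⟪u n (finiteCombination c A (basisVector 1)),
      finiteCombination c A (u n (basisVector 1))⟫_ℂ) atTop (𝓝 0) := by
  have h1 : ∀ n, ⟪u n (finiteCombination c A (basisVector 1)),
      finiteCombination c A (u n (basisVector 1))⟫_ℂ = ∑ a ∈ A, ∑ b ∈ A,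
        c a * (starRingEnd ℂ (c b) * ⟪rightRegular b⁻¹ (u n (basisVector 1)),
          leftRegular a (u n (basisVector 1))⟫_ℂ) := by
    intro n
    rw [finiteCombination_apply_basisVector_one, finiteCombination_apply, map_sum, inner_sum]
    refine Finset.sum_congr rfl fun a _ => ?_
    rw [sum_inner]
    refine Finset.sum_congr rfl fun b _ => ?_
    rw [map_smul, apply_basisVector (hu n), inner_smul_left, inner_smul_right]
    ring
  simp only [h1]
  have h2 := tendsto_finsetSum A fun a ha => tendsto_finsetSum A fun b hb =>
    ((horth a b (hA a ha) (hA b hb)).const_mul (starRingEnd ℂ (c b))).const_mul (c a)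
  simpa using h2

/-- An element of `LG` that asymptotically commutes with a weakly null sequence of unitaries of
`LG`, which itself asymptotically commutes with the `u_h`, `h ∈ H`, belongs to `LH`. -/
theorem IsHyperbolicRelativeTo.mem_groupVN_of_tendsto {𝒢 : Set (Subgroup G)}
    (hG : IsHyperbolicRelativeTo 𝒢) (hH : H ∈ 𝒢) (hinf : Infinite H)
    {u : ℕ → EllTwo G →L[ℂ] EllTwo G} (hu : ∀ n, u n ∈ groupVN (⊤ : Subgroup G))
    (huu : ∀ n, u n ∈ unitary (EllTwo G →L[ℂ] EllTwo G))
    (hweak : ∀ ξ η, Tendsto (fun n => ⟪ξ, u n η⟫_ℂ) atTop (𝓝 0))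
    (hcomm : ∀ h ∈ H, Tendsto (fun n => ‖(leftUnitary h * u n - u n * leftUnitary h)
      (basisVector 1)‖) atTop (𝓝 0))
    {x : EllTwo G →L[ℂ] EllTwo G} (hx : x ∈ groupVN (⊤ : Subgroup G))
    (hxu : Tendsto (fun n => ‖(x * u n - u n * x) (basisVector 1)‖) atTop (𝓝 0)) :
    x ∈ groupVN H := by
  classical
  refine mem_groupVN_of_support hx fun g₀ hg₀ => ?_
  by_contra hne
  set c : G → ℂ := ⇑(x (basisVector 1))
  set ε := ‖c g₀‖ / 3 with hε
  have hεpos : 0 < ε := div_pos (norm_pos_iff.2 hne) (by norm_num)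
  have hnorm : ∀ n, ‖u n (basisVector 1)‖ ≤ 1 := fun n =>
    ((ContinuousLinearMap.norm_map_of_mem_unitary (huu n) _).trans (norm_basisVector 1)).le
  have hnull : ∀ g, Tendsto (fun n => u n (basisVector 1) g) atTop (𝓝 0) := fun g => by
    simpa only [inner_basisVector_left] using hweak (basisVector g) (basisVector 1)
  have hconj : ∀ h ∈ H, Tendsto (fun n => ‖leftRegular h (rightRegular h (u n (basisVector 1))) -
      u n (basisVector 1)‖) atTop (𝓝 0) := fun h hh =>
    (hcomm h hh).congr fun n => norm_commutator_leftUnitary (hu n) h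
  obtain ⟨A, hgA, hA⟩ := exists_norm_sub_finiteCombination_lt x g₀ hεpos
  -- `x = v + w + e` with `v` and `w` supported on and off `H`, and `e` small in `2`-norm.
  set v := finiteCombination c (A.filter (· ∈ H)) with hv
  set w := finiteCombination c (A.filter (· ∉ H)) with hw
  have hvw : finiteCombination c A = v + w :=
    (Finset.sum_filter_add_sum_filter_not A (· ∈ H) _).symm
  obtain ⟨e, he⟩ : ∃ e, e = x - finiteCombination c A := ⟨_, rfl⟩
  rw [← he] at hA
  have heG : e ∈ groupVN (⊤ : Subgroup G) := by
    rw [he]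
    exact sub_mem hx (finiteCombination_mem c A)
  have hwG : w ∈ groupVN (⊤ : Subgroup G) := finiteCombination_mem c _
  have hvu := tendsto_norm_commutator_finiteCombination hcomm c (A := A.filter (· ∈ H))
    fun g hg => (Finset.mem_filter.1 hg).2
  have horth := tendsto_inner_finiteCombination hu
    (fun a b ha hb => hG.tendsto_inner_translates hH hinf hnorm hnull hconj ha hb) c
    (A := A.filter (· ∉ H)) fun g hg => (Finset.mem_filter.1 hg).2
  rw [← hv] at hvu
  rw [← hw] at horth
  have hlarge : 3 * ε ≤ ‖w (basisVector 1)‖ := by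
    have h := norm_le_norm_finiteCombination c (A := A.filter (· ∉ H))
      (Finset.mem_filter.2 ⟨hgA, hg₀⟩)
    rw [← hw] at h
    linarith
  obtain ⟨n, hn₁, hn₂⟩ := (((hxu.add hvu).eventually (gt_mem_nhds
    (show (0 : ℝ) + 0 < ε by simpa using hεpos))).and (horth.norm.eventually (gt_mem_nhds
      (show ‖(0 : ℂ)‖ < ε ^ 2 by rw [norm_zero]; positivity)))).exists
  have hsmall : ‖(w * u n - u n * w) (basisVector 1)‖ ≤ 3 * ε := by
    have h1 : w * u n - u n * w =
        (x * u n - u n * x) - (v * u n - u n * v) - (e * u n - u n * e) := by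
      rw [he, hvw]
      noncomm_ring
    rw [h1, sub_apply, sub_apply _ (v * u n - u n * v)]
    have h2 := norm_sub_le ((x * u n - u n * x) (basisVector 1) -
      (v * u n - u n * v) (basisVector 1)) ((e * u n - u n * e) (basisVector 1))
    have h3 := norm_sub_le ((x * u n - u n * x) (basisVector 1))
      ((v * u n - u n * v) (basisVector 1))
    have h4 := norm_commutator_unitary_le heG (hu n) (huu n)
    linarith
  -- By orthogonality the commutator with `w` has squared norm about `2 ‖w‖₂² ≥ 18 ε²`.
  have hsq := @norm_sub_sq ℂ _ _ _ _ (u n (w (basisVector 1))) (w (u n (basisVector 1)))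
  rw [norm_mul_unitary_apply hwG (hu n) (huu n),
    ContinuousLinearMap.norm_map_of_mem_unitary (huu n)] at hsq
  have h1 : ‖u n (w (basisVector 1)) - w (u n (basisVector 1))‖ ≤ 3 * ε := by
    rw [norm_sub_rev]
    exact hsmall
  have h2 : RCLike.re ⟪u n (w (basisVector 1)), w (u n (basisVector 1))⟫_ℂ ≤ ε ^ 2 :=
    (Complex.re_le_norm _).trans hn₂.le
  have h3 := pow_le_pow_left₀ (norm_nonneg _) h1 2
  have h4 := pow_le_pow_left₀ (by positivity) hlarge 2
  nlinarith

end Maximality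

theorem theoremB {G : Type*} [Group G] (𝒢 : Set (Subgroup G)) (hG : IsHyperbolicRelativeTo 𝒢)
    (H : Subgroup G) (hH : H ∈ 𝒢) (hinf : Infinite H)
    (hΓ : (groupVN H).HasPropertyGamma (groupTrace G)) :
    (groupVN H).IsMaximalGammaIn (groupVN (⊤ : Subgroup G)) (groupTrace G) := by
  have hle : groupVN H ≤ groupVN (⊤ : Subgroup G) := fun x hx =>
    mem_groupVN_iff.2 fun T hT => mem_groupVN_iff.1 hx T fun h _ => hT h (Subgroup.mem_top h)
  refine ⟨⟨hle, hΓ⟩, ?_⟩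
  rintro P ⟨hPG, -, u, hu, hweak, hcomm⟩ hHP x hx
  simp only [traceTwoNorm_groupTrace] at hcomm
  exact hG.mem_groupVN_of_tendsto hH hinf (fun n => hPG (hu n).1) (fun n => (hu n).2) hweak
    (fun h hh => hcomm _ (hHP (leftUnitary_mem_groupVN hh))) (hPG hx) (hcomm x hx)
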